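/- Let $p,q$ be positive integers and let $(\tilde M^{n+1},\tilde g,\tilde\nabla,J)$ be a locally metallic Riemannian manifold: $\tilde g$ is a Riemannian metric with Levi-Civita connection $\tilde\nabla$, and $J$ is a smooth $(1,1)$-tensor field with $J^2=pJ+qI$, $\tilde g(JX,Y)=\tilde g(X,JY)$ and $\tilde\nabla J=0$. Let $\iota:M^n\to\tilde M^{n+1}$ be a smoothly immersed hypersurface with induced metric $g=\iota^*\tilde g$, a global smooth unit normal field $\nu$, and shape operator $A$ given by the Weingarten formula $\tilde\nabla_X\nu=-AX$. Suppose that $M$ is a quadratic metric $\phi$-hypersurface, that is, $M$ carries a smooth $(1,1)$-tensor field $\phi$, a smooth $1$-form $\eta$ and a smooth vector field $\xi$ (the characteristic vector field) such that $$\phi\xi=0,\qquad \eta(\xi)=1,\qquad \phi^2=p\phi+q(I-\eta\otimes\xi),\qquad g(\phi X,Y)=g(X,\phi Y),$$ and which are induced by $J$, i.e. (identifying tangent vectors of $M$ with their images under $d\iota$) $$JX=\phi X+\eta(X)\nu,\qquad J\nu=q\xi+p\nu,\qquad J\xi=\nu$$ for all vector fields $X,Y$ tangent to $M$. Then $\xi$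 is a Killing vector field of $(M,g)$, i.e. $L_\xi g=0$, if and only if $$\phi A+A\phi=2pA .$$ -/

import Mathlib

open Bundle Manifold
open scoped ContDiff

noncomputable section

namespace MetallicGeometry

/-! ### Metallic Riemannian manifolds

`N` is a smooth manifold; its Riemannian metric is given by the instances `RiemannianBundle` and
`IsContMDiffRiemannianBundle` on the tangent bundle. -/

section Ambient

variable {E : Type*} [NormedAddCommGroup E] [NormedSpace ℝ E] [FiniteDimensional ℝ E]
  {H : Type*} [TopologicalSpace H] {I : ModelWithCorners ℝ E H}
  {N : Type*} [TopologicalSpace N] [ChartedSpace H N] [IsManifold I ∞ N]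

/-- `K`, a field of endomorphisms of the tangent spaces, is a smooth `(1,1)` tensor field. -/
def IsSmoothEndomorphismField (K : ∀ y : N, TangentSpace I y →L[ℝ] TangentSpace I y) : Prop :=
  ContMDiff I (I.prod 𝓘(ℝ, E →L[ℝ] E)) ∞
    (fun y ↦ TotalSpace.mk' (E →L[ℝ] E)
      (E := fun y : N ↦ TangentSpace I y →L[ℝ] TangentSpace I y) y (K y))

variable [RiemannianBundle (fun y : N ↦ TangentSpace I y)]

/-- `J` is a metallic structure with parameters `p, q` (positive integers) and the Riemannian
metric of `N` is compatible with it, i.e. `(N, g, J)` is a metallic Riemannian manifold: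
`J² = pJ + qI` and `g(JX, Y) = g(X, JY)`. -/
structure IsMetallicRiemannian (p q : ℕ)
    (J : ∀ y : N, TangentSpace I y →L[ℝ] TangentSpace I y) : Prop where
  p_pos : 0 < p
  q_pos : 0 < q
  smooth : IsSmoothEndomorphismField J
  sq : ∀ (y : N) (u : TangentSpace I y), J y (J y u) = (p : ℝ) • J y u + (q : ℝ) • u
  compatible : ∀ (y : N) (u w : TangentSpace I y), inner ℝ (J y u) w = inner ℝ u (J y w)

/-- `D` is the Levi-Civita connection of the Riemannian metric `g` of `N`: it is torsion-free and
metric, i.e. `X(g(Y, Z)) = g(D_X Y, Z) + g(Y, D_X Z)`.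
(In Mathlib's convention, `D Y y u` is the covariant derivative of `Y` at `y` in direction `u`.) -/
structure IsLeviCivita (D : CovariantDerivative I E (fun y : N ↦ TangentSpace I y)) : Prop where
  torsion_eq_zero : D.torsion = 0
  metric : ∀ (Y Z : ∀ y : N, TangentSpace I y) (y : N),
    MDifferentiableAt I I.tangent (fun z ↦ (⟨z, Y z⟩ : TangentBundle I N)) y →
    MDifferentiableAt I I.tangent (fun z ↦ (⟨z, Z z⟩ : TangentBundle I N)) y →
    ∀ u : TangentSpace I y, mvfderiv I (fun z ↦ inner ℝ (Y z) (Z z)) y u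
      = inner ℝ (D Y y u) (Z y) + inner ℝ (Y y) (D Z y u)

/-- `(N, g, D, J)` is a locally metallic Riemannian manifold: it is a metallic Riemannian manifold,
`D` is the Levi-Civita connection of `g`, and `D J = 0`, i.e. `D_X (J Y) = J (D_X Y)`. -/
structure IsLocallyMetallic (p q : ℕ)
    (D : CovariantDerivative I E (fun y : N ↦ TangentSpace I y))
    (J : ∀ y : N, TangentSpace I y →L[ℝ] TangentSpace I y) : Prop where
  metallic : IsMetallicRiemannian p q J
  leviCivita : IsLeviCivita D
  parallel : ∀ (Y : ∀ y : N, TangentSpace I y) (y : N),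
    MDifferentiableAt I I.tangent (fun z ↦ (⟨z, Y z⟩ : TangentBundle I N)) y →
    ∀ u : TangentSpace I y, D (fun z ↦ J z (Y z)) y u = J y (D Y y u)

end Ambient

/-! ### Intrinsic structures on the hypersurface -/

section Intrinsic

variable {E : Type*} [NormedAddCommGroup E] [NormedSpace ℝ E] [FiniteDimensional ℝ E]
  {H : Type*} [TopologicalSpace H] {I : ModelWithCorners ℝ E H}
  {M : Type*} [TopologicalSpace M] [ChartedSpace H M] [IsManifold I ∞ M]

/-- `(φ, η, ξ)` is an almost quadratic `φ`-structure with coefficients `a, b` on `M`: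
`φ ξ = 0`, `η(ξ) = 1`, `φ² = aφ + b(I - η ⊗ ξ)`, where `b ≠ 0` and `a² + 4b ≠ 0`. -/
structure IsAlmostQuadratic (a b : ℝ)
    (φ : ∀ x : M, TangentSpace I x →L[ℝ] TangentSpace I x)
    (η : ∀ x : M, TangentSpace I x →L[ℝ] ℝ)
    (ξ : ∀ x : M, TangentSpace I x) : Prop where
  b_ne_zero : b ≠ 0
  disc_ne_zero : a ^ 2 + 4 * b ≠ 0
  smooth_φ : IsSmoothEndomorphismField φ
  smooth_η : ContMDiff I (I.prod 𝓘(ℝ, E →L[ℝ] ℝ)) ∞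
    (fun x ↦ TotalSpace.mk' (E →L[ℝ] ℝ) (E := fun x : M ↦ TangentSpace I x →L[ℝ] ℝ) x (η x))
  smooth_ξ : ContMDiff I I.tangent ∞ (fun x ↦ (⟨x, ξ x⟩ : TangentBundle I M))
  φ_ξ : ∀ x, φ x (ξ x) = 0
  η_ξ : ∀ x, η x (ξ x) = 1
  sq : ∀ (x : M) (v : TangentSpace I x),
    φ x (φ x v) = a • φ x v + b • (v - η x v • ξ x)

/-- The Lie derivative `(L_X g)(Y, Z) = X(g(Y, Z)) - g([X, Y], Z) - g(Y, [X, Z])` at `x` of a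
covariant 2-tensor field `g` on `M`. -/
def lieDerivMetric (g : ∀ x : M, TangentSpace I x → TangentSpace I x → ℝ)
    (X Y Z : ∀ x : M, TangentSpace I x) (x : M) : ℝ :=
  mvfderiv I (fun y ↦ g y (Y y) (Z y)) x (X x)
    - g x (VectorField.mlieBracket I X Y x) (Z x)
    - g x (Y x) (VectorField.mlieBracket I X Z x)

/-- `X` is a Killing vector field for `g`: `L_X g = 0`. -/
def IsKilling (g : ∀ x : M, TangentSpace I x → TangentSpace I x → ℝ)
    (X : ∀ x : M, TangentSpace I x) : Prop :=
  ∀ (Y Z : ∀ x : M, TangentSpace I x) (x : M),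
    MDifferentiableAt I I.tangent (fun y ↦ (⟨y, Y y⟩ : TangentBundle I M)) x →
    MDifferentiableAt I I.tangent (fun y ↦ (⟨y, Z y⟩ : TangentBundle I M)) x →
    lieDerivMetric g X Y Z x = 0

end Intrinsic

/-! ### Hypersurfaces -/

section Hypersurface

variable {E : Type*} [NormedAddCommGroup E] [NormedSpace ℝ E] [FiniteDimensional ℝ E]
  {H : Type*} [TopologicalSpace H] {I : ModelWithCorners ℝ E H}
  {M : Type*} [TopologicalSpace M] [ChartedSpace H M] [IsManifold I ∞ M]
  {E' : Type*} [NormedAddCommGroup E'] [NormedSpace ℝ E'] [FiniteDimensional ℝ E']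
  {H' : Type*} [TopologicalSpace H'] {I' : ModelWithCorners ℝ E' H'}
  {N : Type*} [TopologicalSpace N] [ChartedSpace H' N] [IsManifold I' ∞ N]

variable (I I') in
/-- The metric on `M` induced by `ι : M → N` from the Riemannian metric of `N`. -/
def inducedMetric [RiemannianBundle (fun y : N ↦ TangentSpace I' y)] (ι : M → N) (x : M)
    (v w : TangentSpace I x) : ℝ :=
  inner ℝ (mfderiv I I' ι x v) (mfderiv I I' ι x w)

/-- The coordinates of a vector field `V` along `ι : M → N` in the trivialization of the tangent
bundle of `N` around `ι x₀`. -/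
def coordAlong (ι : M → N) (V : ∀ x : M, TangentSpace I' (ι x)) (x₀ x : M) : E' :=
  (trivializationAt E' (fun y : N ↦ TangentSpace I' y) (ι x₀) ⟨ι x, V x⟩).2

variable (I) in
/-- The covariant derivative `v ↦ D_v V` at `x` of a vector field `V` along `ι : M → N` (the
pull-back of the connection `D`). Writing `V = ∑ cᵢ (eᵢ ∘ ι)` in the local frame `eᵢ` given by the
trivialization of the tangent bundle of `N` around `ι x`, it is
`D_v V = ∑ dcᵢ(v) eᵢ(ι x) + ∑ cᵢ(x) D_{dι(v)} eᵢ`. The field `∑ cᵢ(x) eᵢ`, which has constant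
coefficients, is `FiberBundle.extend E' (V x)`. -/
def covDerivAlong (D : CovariantDerivative I' E' (fun y : N ↦ TangentSpace I' y))
    (ι : M → N) (V : ∀ x : M, TangentSpace I' (ι x)) (x : M) :
    TangentSpace I x →L[ℝ] TangentSpace I' (ι x) :=
  ((trivializationAt E' (fun y : N ↦ TangentSpace I' y) (ι x)).symmL ℝ (ι x)).comp
      (mvfderiv I (coordAlong ι V x) x)
    + (D (FiberBundle.extend E' (V x)) (ι x)).comp (mfderiv I I' ι x)

variable (I) in
/-- The shape operator `A` of the immersion `ι : M → N` with respect to the normal field `ν`,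
given by the Weingarten formula `D_v ν = -dι(A v)`. (When `ν` is a unit normal field of an immersed
hypersurface, `D_v ν` lies in the image of the injective map `dι`.) -/
def shapeOperator (D : CovariantDerivative I' E' (fun y : N ↦ TangentSpace I' y))
    (ι : M → N) (ν : ∀ x : M, TangentSpace I' (ι x)) (x : M) :
    TangentSpace I x →ₗ[ℝ] TangentSpace I x :=
  -((mfderiv I I' ι x).toLinearMap.leftInverse ∘ₗ (covDerivAlong I D ι ν x).toLinearMap)

variable [RiemannianBundle (fun y : N ↦ TangentSpace I' y)]

variable (I I') in
/-- `ι : M → N` is a smooth immersion and `ν` is a smooth unit normal vector field along it. -/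
structure IsImmersionWithUnitNormal (ι : M → N) (ν : ∀ x : M, TangentSpace I' (ι x)) : Prop where
  smooth : ContMDiff I I' ∞ ι
  injective : ∀ x, Function.Injective (mfderiv I I' ι x)
  smooth_normal : ContMDiff I I'.tangent ∞ (fun x ↦ (⟨ι x, ν x⟩ : TangentBundle I' N))
  unit : ∀ x, inner ℝ (ν x) (ν x) = 1
  normal : ∀ (x : M) (v : TangentSpace I x), inner ℝ (mfderiv I I' ι x v) (ν x) = 0

/-- The immersed hypersurface `ι : M → N` with unit normal `ν`, with its induced metric `g`, is a
quadratic metric `φ`-hypersurface of the metallic Riemannian manifold `(N, J)` with structure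
`(φ, η, ξ)`: this is an almost quadratic `φ`-structure with which `g` is compatible, and it is
induced by `J` through
`JX = φX + η(X)ν`, `Jν = qξ + pν`, `Jξ = ν`, where tangent vectors of `M` are identified with
their images under `dι`. The length of `ξ` is not prescribed: these relations give
`q g(ξ, ξ) = 1`, so the structures with `g(ξ, ξ) = 1` are those with `q = 1`. -/
structure IsQuadraticMetricHypersurface (p q : ℕ)
    (J : ∀ y : N, TangentSpace I' y →L[ℝ] TangentSpace I' y)
    (ι : M → N) (ν : ∀ x : M, TangentSpace I' (ι x))
    (φ : ∀ x : M, TangentSpace I x →L[ℝ] TangentSpace I x)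
    (η : ∀ x : M, TangentSpace I x →L[ℝ] ℝ)
    (ξ : ∀ x : M, TangentSpace I x) : Prop where
  immersion : IsImmersionWithUnitNormal I I' ι ν
  almostQuadratic : IsAlmostQuadratic (p : ℝ) (q : ℝ) φ η ξ
  compatible : ∀ (x : M) (v w : TangentSpace I x),
    inducedMetric I I' ι x (φ x v) w = inducedMetric I I' ι x v (φ x w)
  J_tangent : ∀ (x : M) (v : TangentSpace I x),
    J (ι x) (mfderiv I I' ι x v) = mfderiv I I' ι x (φ x v) + η x v • ν x
  J_normal : ∀ x : M,
    J (ι x) (ν x) = (q : ℝ) • mfderiv I I' ι x (ξ x) + (p : ℝ) • ν x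
  J_ξ : ∀ x : M, J (ι x) (mfderiv I I' ι x (ξ x)) = ν x

end Hypersurface

end MetallicGeometry

end

/-! Since `J` is parallel, differentiating `Jν = qξ + pν` in a tangent direction `v` and inserting
the Weingarten formula gives `q D_v ξ = pAv - φAv - η(Av)ν` (`covDerivAlong_characteristic`). The
Levi-Civita property gives `(L_ξ g)(Y, Z) = g(D_Y ξ, Z) + g(Y, D_Z ξ)`
(`lieDerivMetric_inducedMetric`). The normal part drops out, and symmetry of `A` and `φ` turns `q
L_ξ g` into the bilinear form of `2pA - φA - Aφ` (`lieDerivMetric_characteristic`). As `q ≠ 0` and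
`g` is nondegenerate, one vanishes exactly when the other does.

The bulk of the work is calculus for vector fields along `ι`, which need not be restrictions of
fields on `N`. Such a field is locally a combination, with function coefficients, of restricted
fields, so the product rule for the metric and commutation with `J` pass from `N` to `ι` by
`MDiffAlongAt.induction`. Vanishing torsion passes over by a computation in coordinates
(`covDerivAlong_pushforward_sub`). -/

namespace MetallicGeometry

open VectorField Set Filter
open scoped Topology

/-! ### The Lie bracket as a commutator of derivations. -/

section LieBracket

variable {E : Type*} [NormedAddCommGroup E] [NormedSpace ℝ E]
  {H : Type*} [TopologicalSpace H] {I : ModelWithCorners ℝ E H} [I.Boundaryless]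
  {M : Type*} [TopologicalSpace M] [ChartedSpace H M]
  {F : Type*} [NormedAddCommGroup F] [NormedSpace ℝ F]

/-- The expression in the chart at `x` of the vector field `X`. -/
noncomputable def chartField (I : ModelWithCorners ℝ E H) (X : ∀ z : M, TangentSpace I z) (x : M) :
    E → E :=
  mpullbackWithin 𝓘(ℝ, E) I (extChartAt I x).symm X (range I)

lemma differentiableAt_chartField [FiniteDimensional ℝ E] [IsManifold I 2 M]
    {X : ∀ z : M, TangentSpace I z} {x : M}
    (hX : MDifferentiableAt I I.tangent (fun z ↦ (⟨z, X z⟩ : TangentBundle I M)) x) :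
    DifferentiableAt ℝ (chartField I X x) (extChartAt I x x) := by
  have h : DifferentiableWithinAt ℝ (chartField I X x) _ _ :=
    (mdifferentiableWithinAt_univ.2 hX).differentiableWithinAt_mpullbackWithin_vectorField
  rwa [I.range_eq_univ, preimage_univ, univ_inter, differentiableWithinAt_univ] at h

omit [I.Boundaryless] in
lemma chartField_self [IsManifold I 1 M] (X : ∀ z : M, TangentSpace I z) (x : M) :
    chartField I X x (extChartAt I x x) = X x := by
  have h := mfderivWithin_range_extChartAt_symm (I := I) (x := x)
  have h2 : (show E →L[ℝ] E from
      mfderivWithin 𝓘(ℝ, E) I (extChartAt I x).symm (range I) (extChartAt I x x)) =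
      ContinuousLinearMap.id ℝ E := h
  -- The type of `X y` varies with `y`, so the base point cannot simply be rewritten; the values are
  -- compared in the model space `E`.
  have e : ∀ y, y = x → (show E from X y) = X x := by rintro y rfl; rfl
  change (show E →L[ℝ] E from mfderivWithin 𝓘(ℝ, E) I (extChartAt I x).symm (range I)
    (extChartAt I x x)).inverse (show E from X ((extChartAt I x).symm (extChartAt I x x))) = _
  rw [h2, ContinuousLinearMap.inverse_id]
  exact e _ (extChartAt_to_inv x)

lemma contDiffAt_comp_extChartAt_symm {n : ℕ∞ω} {f : M → F} {x : M}
    (hf : ContMDiffAt I 𝓘(ℝ, F) n f x) :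
    ContDiffAt ℝ n (f ∘ (extChartAt I x).symm) (extChartAt I x x) := by
  have h := (contMDiffAt_iff.1 hf).2
  rw [I.range_eq_univ, contDiffWithinAt_univ] at h
  exact h

/-- Pulling `X` back applies the inverse of the derivative of the inverse chart, and the chain rule
applies that derivative again, so the two cancel. -/
lemma fderiv_chartField [IsManifold I 1 M] {f : M → F} {x z : M}
    (hf : MDifferentiableAt I 𝓘(ℝ, F) f z) (hz : z ∈ (extChartAt I x).source)
    (X : ∀ z : M, TangentSpace I z) :
    fderiv ℝ (f ∘ (extChartAt I x).symm) (extChartAt I x z) (chartField I X x (extChartAt I x z)) =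
      mvfderiv I f z (X z) := by
  have hu := (extChartAt I x).map_source hz
  have hl := (extChartAt I x).left_inv hz
  set u := extChartAt I x z
  have hd : MDifferentiableAt I 𝓘(ℝ, F) f ((extChartAt I x).symm u) := hl.symm ▸ hf
  have hs := mdifferentiableWithinAt_extChartAt_symm (I := I) hu
  have hc := mfderiv_comp_mfderivWithin u hd hs
    (I.uniqueMDiffOn _ (by rw [I.range_eq_univ]; trivial))
  have hi := isInvertible_mfderivWithin_extChartAt_symm (I := I) hu
  have hc' : fderiv ℝ (f ∘ (extChartAt I x).symm) u =
      (mvfderiv I f ((extChartAt I x).symm u)).comp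
        (mfderivWithin 𝓘(ℝ, E) I (extChartAt I x).symm (range I) u) := by
    rw [← fderivWithin_univ, ← I.range_eq_univ]
    exact mfderivWithin_eq_fderivWithin.symm.trans hc
  have e : ∀ y, y = z → mvfderiv I f y (X y) = mvfderiv I f z (X z) := by rintro y rfl; rfl
  rw [hc', ← e _ hl]
  exact congrArg (mvfderiv I f ((extChartAt I x).symm u)) (hi.self_apply_inverse _)

omit [I.Boundaryless] in
lemma mvfderiv_eq_fderiv_comp [IsManifold I 1 M] {f : M → F} {g : E → F} {x : M}
    (hfg : f =ᶠ[𝓝 x] g ∘ extChartAt I x) (hg : DifferentiableAt ℝ g (extChartAt I x x))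
    (v : TangentSpace I x) :
    mvfderiv I f x v = fderiv ℝ g (extChartAt I x x) v := by
  have h1 : mfderiv I 𝓘(ℝ, F) f x =
      (mfderiv 𝓘(ℝ, E) 𝓘(ℝ, F) g (extChartAt I x x)).comp
        (mfderiv I 𝓘(ℝ, E) (extChartAt I x) x) := by
    rw [hfg.mfderiv_eq]
    exact mfderiv_comp x hg.mdifferentiableAt (mdifferentiableAt_extChartAt (mem_chart_source H x))
  rw [mfderiv_extChartAt_self, mfderiv_eq_fderiv] at h1
  exact congrArg (fun L ↦ L v) h1

/-- The derivation of functions given by the Lie bracket is the commutator of derivations. -/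
theorem mvfderiv_mlieBracket [FiniteDimensional ℝ E] [IsManifold I 2 M] {f : M → F} {x : M}
    (hf : ContMDiffAt I 𝓘(ℝ, F) 2 f x) {X Y : ∀ z : M, TangentSpace I z}
    (hX : MDifferentiableAt I I.tangent (fun z ↦ (⟨z, X z⟩ : TangentBundle I M)) x)
    (hY : MDifferentiableAt I I.tangent (fun z ↦ (⟨z, Y z⟩ : TangentBundle I M)) x) :
    mvfderiv I (fun z ↦ mvfderiv I f z (Y z)) x (X x)
      - mvfderiv I (fun z ↦ mvfderiv I f z (X z)) x (Y x)
      = mvfderiv I f x (mlieBracket I X Y x) := by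
  have : IsManifold I 1 M := IsManifold.of_le (n := 2) one_le_two
  set G := f ∘ (extChartAt I x).symm
  set u := extChartAt I x x
  have hG : ContDiffAt ℝ 2 G u := contDiffAt_comp_extChartAt_symm hf
  have hG' : DifferentiableAt ℝ (fderiv ℝ G) u :=
    (hG.fderiv_right (m := 1) (by norm_num)).differentiableAt one_ne_zero
  -- In the chart, `V(W f)` is a second-derivative term plus the derivative of `G` along `DW(V)`.
  -- The former is symmetric in `V`, `W` and cancels in the commutator; the latter terms assemble
  -- into the bracket.
  have key : ∀ V W : (∀ z : M, TangentSpace I z),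
      MDifferentiableAt I I.tangent (fun z ↦ (⟨z, W z⟩ : TangentBundle I M)) x →
      mvfderiv I (fun z ↦ mvfderiv I f z (W z)) x (V x) =
        fderiv ℝ (fderiv ℝ G) u (chartField I V x u) (chartField I W x u)
          + fderiv ℝ G u (fderiv ℝ (chartField I W x) u (chartField I V x u)) := by
    intro V W hW
    have hW' := differentiableAt_chartField hW
    have hev : (fun z ↦ mvfderiv I f z (W z)) =ᶠ[𝓝 x]
        (fun w ↦ fderiv ℝ G w (chartField I W x w)) ∘ extChartAt I x := by
      filter_upwards [(contMDiffAt_iff_contMDiffAt_nhds (by simp)).1 hf,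
        extChartAt_source_mem_nhds (I := I) x] with z hz hz'
      exact (fderiv_chartField (ContMDiffAt.mdifferentiableAt hz two_ne_zero) hz' W).symm
    rw [mvfderiv_eq_fderiv_comp hev (hG'.clm_apply hW'), fderiv_clm_apply hG' hW',
      ← chartField_self V x]
    simp [u, add_comm]
  have hb : mvfderiv I f x (mlieBracket I X Y x) =
      fderiv ℝ G u (lieBracket ℝ (chartField I X x) (chartField I Y x) u) := by
    have hev : f =ᶠ[𝓝 x] G ∘ extChartAt I x := by
      filter_upwards [extChartAt_source_mem_nhds (I := I) x] with z hz
      exact (congrArg f ((extChartAt I x).left_inv hz)).symm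
    rw [mvfderiv_eq_fderiv_comp hev (hG.differentiableAt two_ne_zero)]
    congr 1
    have h2 : (show E →L[ℝ] E from mfderiv I 𝓘(ℝ, E) (extChartAt I x) x).inverse =
        ContinuousLinearMap.id ℝ E := by
      rw [mfderiv_extChartAt_self]; exact ContinuousLinearMap.inverse_id
    change (show E →L[ℝ] E from mfderiv I 𝓘(ℝ, E) (extChartAt I x) x).inverse
      (lieBracketWithin ℝ (chartField I X x) (chartField I Y x) _ u) = _
    rw [h2, preimage_univ, I.range_eq_univ, univ_inter, lieBracketWithin_univ]
    rfl
  have hsymm : IsSymmSndFDerivAt ℝ G u := hG.isSymmSndFDerivAt (by simp)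
  rw [key X Y hY, key Y X hX, hb, lieBracket_eq, map_sub,
    hsymm.eq (chartField I X x u) (chartField I Y x u)]
  abel

end LieBracket

/-! ### Covariant differentiation of vector fields along a map. -/

section Along

variable {E : Type*} [NormedAddCommGroup E] [NormedSpace ℝ E]
  {H : Type*} [TopologicalSpace H] {I : ModelWithCorners ℝ E H}
  {M : Type*} [TopologicalSpace M] [ChartedSpace H M]
  {E' : Type*} [NormedAddCommGroup E'] [NormedSpace ℝ E']
  {H' : Type*} [TopologicalSpace H'] {I' : ModelWithCorners ℝ E' H'}
  {N : Type*} [TopologicalSpace N] [ChartedSpace H' N] [IsManifold I' ∞ N]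

variable (I I') in
/-- The vector field `V` along `ι` is differentiable at `x`. -/
def MDiffAlongAt (ι : M → N) (V : ∀ x : M, TangentSpace I' (ι x)) (x : M) : Prop :=
  MDifferentiableAt I I'.tangent (fun z ↦ (⟨ι z, V z⟩ : TangentBundle I' N)) x

variable {ι : M → N} {V W : ∀ x : M, TangentSpace I' (ι x)} {x : M}

lemma mdiffAlongAt_iff :
    MDiffAlongAt I I' ι V x ↔
      MDifferentiableAt I I' ι x ∧ MDifferentiableAt I 𝓘(ℝ, E') (coordAlong ι V x) x :=
  mdifferentiableAt_totalSpace ..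

omit [TopologicalSpace M] in
lemma coordAlong_self_apply (V : ∀ x : M, TangentSpace I' (ι x)) (x z : M)
    (hz : ι z ∈ (trivializationAt E' (fun y : N ↦ TangentSpace I' y) (ι x)).baseSet) :
    coordAlong ι V x z =
      (trivializationAt E' (fun y : N ↦ TangentSpace I' y) (ι x)).continuousLinearMapAt ℝ (ι z)
        (V z) := by
  rw [Trivialization.continuousLinearMapAt_apply, Trivialization.linearMapAt_apply, if_pos hz]
  rfl

lemma eventually_mem_baseSet (h : MDifferentiableAt I I' ι x) :
    ∀ᶠ z in 𝓝 x, ι z ∈ (trivializationAt E' (fun y : N ↦ TangentSpace I' y) (ι x)).baseSet :=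
  h.continuousAt.preimage_mem_nhds
    ((trivializationAt E' _ (ι x)).open_baseSet.mem_nhds
    (mem_baseSet_trivializationAt ..))

lemma coordAlong_add (h : MDifferentiableAt I I' ι x) :
    coordAlong ι (fun z ↦ V z + W z) x =ᶠ[𝓝 x] coordAlong ι V x + coordAlong ι W x := by
  filter_upwards [eventually_mem_baseSet h] with z hz
  simp only [Pi.add_apply, coordAlong_self_apply _ _ _ hz, map_add]

lemma coordAlong_smul (h : MDifferentiableAt I I' ι x) (f : M → ℝ) :
    coordAlong ι (fun z ↦ f z • V z) x =ᶠ[𝓝 x] f • coordAlong ι V x := by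
  filter_upwards [eventually_mem_baseSet h] with z hz
  simp only [Pi.smul_apply', coordAlong_self_apply _ _ _ hz, map_smul]

lemma MDiffAlongAt.add (hV : MDiffAlongAt I I' ι V x) (hW : MDiffAlongAt I I' ι W x) :
    MDiffAlongAt I I' ι (fun z ↦ V z + W z) x := by
  rw [mdiffAlongAt_iff] at *
  exact ⟨hV.1, (hV.2.add hW.2).congr_of_eventuallyEq (coordAlong_add hV.1)⟩

lemma MDiffAlongAt.smul {f : M → ℝ} (hf : MDifferentiableAt I 𝓘(ℝ, ℝ) f x)
    (hV : MDiffAlongAt I I' ι V x) : MDiffAlongAt I I' ι (fun z ↦ f z • V z) x := by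
  rw [mdiffAlongAt_iff] at *
  exact ⟨hV.1, (hf.smul hV.2).congr_of_eventuallyEq (coordAlong_smul hV.1 f)⟩

lemma coordAlong_congr (h : ∀ᶠ z in 𝓝 x, V z = W z) :
    coordAlong ι V x =ᶠ[𝓝 x] coordAlong ι W x := by
  filter_upwards [h] with z hz
  simp only [coordAlong, hz]

lemma MDiffAlongAt.congr (hV : MDiffAlongAt I I' ι V x) (h : ∀ᶠ z in 𝓝 x, V z = W z) :
    MDiffAlongAt I I' ι W x := by
  rw [mdiffAlongAt_iff] at *
  exact ⟨hV.1, hV.2.congr_of_eventuallyEq (coordAlong_congr h).symm⟩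

/-- Near `y₀`, the extension has constant coordinates. Its linearity in `u` and the vanishing of its
coordinate derivative both come from this formula. -/
lemma extend_apply_eq_symmL {y₀ : N} (u : TangentSpace I' y₀) {y : N}
    (hy : y ∈ (trivializationAt E' (fun y : N ↦ TangentSpace I' y) y₀).baseSet) :
    FiberBundle.extend E' u y =
      (trivializationAt E' (fun y : N ↦ TangentSpace I' y) y₀).symmL ℝ y
        ((trivializationAt E' (fun y : N ↦ TangentSpace I' y) y₀).continuousLinearMapAt ℝ y₀ u) := by
  rw [Trivialization.symmL_apply _ hy, Trivialization.continuousLinearMapAt_apply,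
    Trivialization.linearMapAt_apply, if_pos (mem_baseSet_trivializationAt ..)]
  rfl

lemma eventually_baseSet (y₀ : N) :
    ∀ᶠ y in 𝓝 y₀, y ∈ (trivializationAt E' (fun y : N ↦ TangentSpace I' y) y₀).baseSet :=
  (trivializationAt E' (fun y : N ↦ TangentSpace I' y) y₀).open_baseSet.mem_nhds
    (mem_baseSet_trivializationAt ..)

lemma eventually_extend_add {y₀ : N} (u w : TangentSpace I' y₀) :
    ∀ᶠ y in 𝓝 y₀, FiberBundle.extend E' (u + w) y =
      (FiberBundle.extend E' u + FiberBundle.extend E' w : ∀ y : N, TangentSpace I' y) y := by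
  filter_upwards [eventually_baseSet (I' := I') y₀] with y hy
  simp only [Pi.add_apply, extend_apply_eq_symmL _ hy, map_add]

lemma eventually_extend_smul {y₀ : N} (c : ℝ) (u : TangentSpace I' y₀) :
    ∀ᶠ y in 𝓝 y₀, FiberBundle.extend E' (c • u) y =
      (c • FiberBundle.extend E' u : ∀ y : N, TangentSpace I' y) y := by
  filter_upwards [eventually_baseSet (I' := I') y₀] with y hy
  simp only [Pi.smul_apply, extend_apply_eq_symmL _ hy, map_smul]

lemma mdiffAt_extend {y₀ : N} (u : TangentSpace I' y₀) :
    MDifferentiableAt I' I'.tangent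
      (fun y ↦ (⟨y, FiberBundle.extend E' u y⟩ : TangentBundle I' N)) y₀ :=
  FiberBundle.mdifferentiableAt_extend I' E' u

variable {D : CovariantDerivative I' E' (fun y : N ↦ TangentSpace I' y)}

/-- The extension is known to be additive only near `y₀`, which suffices because `D` is local. With
the scalar analogue, this makes the connection term of `covDerivAlong` linear in `V x`. -/
lemma covDeriv_extend_add {y₀ : N} (u w : TangentSpace I' y₀) :
    D (FiberBundle.extend E' (u + w)) y₀ =
      D (FiberBundle.extend E' u) y₀ + D (FiberBundle.extend E' w) y₀ := by
  rw [← D.isCovariantDerivativeOnUniv.add (mdiffAt_extend u) (mdiffAt_extend w)]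
  exact D.isCovariantDerivativeOnUniv.congr_of_eventuallyEq (mdiffAt_extend _)
    (mdifferentiableAt_add_section (mdiffAt_extend u) (mdiffAt_extend w)) univ_mem
    (eventually_extend_add u w)

lemma covDeriv_extend_smul {y₀ : N} (c : ℝ) (u : TangentSpace I' y₀) :
    D (FiberBundle.extend E' (c • u)) y₀ = c • D (FiberBundle.extend E' u) y₀ := by
  rw [← D.isCovariantDerivativeOnUniv.smul_const c (mdiffAt_extend u)]
  exact D.isCovariantDerivativeOnUniv.congr_of_eventuallyEq (mdiffAt_extend _)
    (mdifferentiableAt_const.smul_section (mdiffAt_extend u)) univ_mem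
    (eventually_extend_smul c u)

lemma mvfderiv_congr {F : Type*} [NormedAddCommGroup F] [NormedSpace ℝ F] {f g : M → F}
    (h : f =ᶠ[𝓝 x] g) : mvfderiv I f x = mvfderiv I g x :=
  h.mfderiv_eq

lemma covDerivAlong_congr (h : ∀ᶠ z in 𝓝 x, V z = W z) :
    covDerivAlong I D ι V x = covDerivAlong I D ι W x := by
  have h' : mvfderiv I (coordAlong ι V x) x = mvfderiv I (coordAlong ι W x) x :=
    mvfderiv_congr (coordAlong_congr h)
  rw [covDerivAlong, covDerivAlong, h.self_of_nhds, h']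

lemma covDerivAlong_add (hV : MDiffAlongAt I I' ι V x) (hW : MDiffAlongAt I I' ι W x) :
    covDerivAlong I D ι (fun z ↦ V z + W z) x =
      covDerivAlong I D ι V x + covDerivAlong I D ι W x := by
  rw [mdiffAlongAt_iff] at hV hW
  have h' : mvfderiv I (coordAlong ι (fun z ↦ V z + W z) x) x =
      mvfderiv I (coordAlong ι V x) x + mvfderiv I (coordAlong ι W x) x :=
    (mvfderiv_congr (coordAlong_add hV.1)).trans (mvfderiv_add hV.2 hW.2)
  rw [covDerivAlong, covDerivAlong, covDerivAlong, h', covDeriv_extend_add]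
  ext v
  simp only [add_apply, ContinuousLinearMap.comp_apply, map_add]
  abel

/-- The derivative of `f` enters only through the coordinate term, where `symmL` rebuilds `V x` from
its coordinates. -/
lemma covDerivAlong_smul {f : M → ℝ} (hf : MDifferentiableAt I 𝓘(ℝ, ℝ) f x)
    (hV : MDiffAlongAt I I' ι V x) (v : TangentSpace I x) :
    covDerivAlong I D ι (fun z ↦ f z • V z) x v =
      f x • covDerivAlong I D ι V x v + mvfderiv I f x v • V x := by
  rw [mdiffAlongAt_iff] at hV
  have h' : mvfderiv I (coordAlong ι (fun z ↦ f z • V z) x) x =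
      f x • mvfderiv I (coordAlong ι V x) x + (mvfderiv I f x).smulRight (coordAlong ι V x x) :=
    (mvfderiv_congr (coordAlong_smul hV.1 f)).trans (mvfderiv_smul hf hV.2)
  have hx := mem_baseSet_trivializationAt E' (fun y : N ↦ TangentSpace I' y) (ι x)
  rw [covDerivAlong, covDerivAlong, h', covDeriv_extend_smul]
  simp only [add_apply, ContinuousLinearMap.comp_apply, map_add,
    smul_apply, map_smul, ContinuousLinearMap.smulRight_apply, smul_add,
    coordAlong_self_apply _ _ _ hx, Trivialization.symmL_continuousLinearMapAt _ hx]
  abel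

lemma covDerivAlong_const_smul (c : ℝ) (hV : MDiffAlongAt I I' ι V x) :
    covDerivAlong I D ι (fun z ↦ c • V z) x = c • covDerivAlong I D ι V x := by
  ext v
  have := covDerivAlong_smul (D := D) (f := fun _ ↦ c) mdifferentiableAt_const hV v
  simpa [mvfderiv_const] using this

lemma mvfderiv_const_of_eventually {f : M → E'} {c : E'} (h : ∀ᶠ z in 𝓝 x, f z = c) :
    mvfderiv I f x = 0 :=
  (mvfderiv_congr h).trans (mvfderiv_const c)

lemma coordAlong_id_extend {y₀ : N} (u : TangentSpace I' y₀) :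
    ∀ᶠ y in 𝓝 y₀,
      coordAlong (I' := I') id (FiberBundle.extend E' (E := fun y : N ↦ TangentSpace I' y) u) y₀ y =
      (trivializationAt E' (fun y : N ↦ TangentSpace I' y) y₀).continuousLinearMapAt ℝ y₀ u := by
  filter_upwards [eventually_baseSet (I' := I') y₀] with y hy
  rw [coordAlong_self_apply _ _ _ (by exact hy)]
  exact (congrArg _ (extend_apply_eq_symmL u hy)).trans
    (Trivialization.continuousLinearMapAt_symmL _ hy _)

lemma covDerivAlong_id_extend {y₀ : N} (u : TangentSpace I' y₀) :
    covDerivAlong I' D id (FiberBundle.extend E' (E := fun y : N ↦ TangentSpace I' y) u) y₀ =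
      D (FiberBundle.extend E' u) y₀ := by
  rw [covDerivAlong, mvfderiv_const_of_eventually (coordAlong_id_extend u), mfderiv_id]
  have h : FiberBundle.extend E' u y₀ = u := FiberBundle.extend_apply_self ..
  ext v
  simp only [id, h]
  simp

/-- For `ι = id` the coordinate formula satisfies the sum and Leibniz rules, so its difference from
`D` is tensorial. The difference may thus be evaluated on the constant-coordinate extension of `S
y`, where the two agree. -/
lemma covDerivAlong_id [FiniteDimensional ℝ E'] {S : ∀ y : N, TangentSpace I' y} {y : N}
    (hS : MDifferentiableAt I' I'.tangent (fun z ↦ (⟨z, S z⟩ : TangentBundle I' N)) y) :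
    covDerivAlong I' D id S y = D S y := by
  have h : IsCovariantDerivativeOn E' (fun S y ↦ covDerivAlong I' D id S y :
      (∀ y : N, TangentSpace I' y) → ∀ y : N, TangentSpace I' y →L[ℝ] TangentSpace I' y) := by
    constructor
    · intro σ σ' x hσ hσ' _
      exact covDerivAlong_add hσ hσ'
    · intro σ g x hσ hg _
      ext v
      exact covDerivAlong_smul hg hσ v
  have key := h.difference_apply D.isCovariantDerivativeOnUniv (hσ := hS)
  have key' := h.difference_apply D.isCovariantDerivativeOnUniv (hσ := mdiffAt_extend (S y))
  rw [covDerivAlong_id_extend, sub_self, FiberBundle.extend_apply_self] at key'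
  exact sub_eq_zero.1 (key.symm.trans key')

/-- The coordinates of `S ∘ ι` are those of `S` composed with `ι`, so the chain rule reduces the
claim to the case of the identity map. -/
lemma covDerivAlong_comp [FiniteDimensional ℝ E'] {S : ∀ y : N, TangentSpace I' y}
    (hι : MDifferentiableAt I I' ι x)
    (hS : MDifferentiableAt I' I'.tangent (fun z ↦ (⟨z, S z⟩ : TangentBundle I' N)) (ι x)) :
    covDerivAlong I D ι (fun z ↦ S (ι z)) x = (D S (ι x)).comp (mfderiv I I' ι x) := by
  have hS' : MDiffAlongAt I' I' id S (ι x) := hS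
  rw [mdiffAlongAt_iff] at hS'
  have h : mvfderiv I (coordAlong ι (fun z ↦ S (ι z)) x) x =
      (mvfderiv I' (coordAlong (I' := I') id S (ι x)) (ι x)).comp (mfderiv I I' ι x) :=
    mfderiv_comp (f := ι) (g := coordAlong (I' := I') id S (ι x)) x hS'.2 hι
  rw [← covDerivAlong_id hS, covDerivAlong, covDerivAlong, h, mfderiv_id]
  rfl

/-- A property of vector fields along `ι` that is compatible with sums and products with functions,
and holds for the restrictions of vector fields of `N`, holds for all vector fields along `ι`. -/
theorem MDiffAlongAt.induction [FiniteDimensional ℝ E']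
    {P : (∀ x : M, TangentSpace I' (ι x)) → Prop}
    (hι : MDifferentiableAt I I' ι x)
    (congr : ∀ V W, MDiffAlongAt I I' ι V x → (∀ᶠ z in 𝓝 x, V z = W z) → P V → P W)
    (add : ∀ V W, MDiffAlongAt I I' ι V x → MDiffAlongAt I I' ι W x → P V → P W →
      P (fun z ↦ V z + W z))
    (smul : ∀ (f : M → ℝ) (V), MDifferentiableAt I 𝓘(ℝ, ℝ) f x → MDiffAlongAt I I' ι V x → P V →
      P (fun z ↦ f z • V z))
    (comp : ∀ S : (∀ y : N, TangentSpace I' y),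
      MDifferentiableAt I' I'.tangent (fun z ↦ (⟨z, S z⟩ : TangentBundle I' N)) (ι x) →
      P (fun z ↦ S (ι z)))
    {V : ∀ x : M, TangentSpace I' (ι x)} (hV : MDiffAlongAt I I' ι V x) : P V := by
  rw [mdiffAlongAt_iff] at hV
  set e := trivializationAt E' (fun y : N ↦ TangentSpace I' y) (ι x)
  have hx : ι x ∈ e.baseSet := mem_baseSet_trivializationAt ..
  let b := Module.finBasis ℝ E'
  let f : _ → M → ℝ := fun i z ↦ b.repr (coordAlong ι V x z) i
  let S : _ → ∀ y : N, TangentSpace I' y := fun i ↦ FiberBundle.extend E' (e.symmL ℝ (ι x) (b i))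
  have hf : ∀ i, MDifferentiableAt I 𝓘(ℝ, ℝ) (f i) x := fun i ↦
    (LinearMap.toContinuousLinearMap (b.coord i)).differentiableAt.comp_mdifferentiableAt hV.2
  have hS : ∀ i, MDifferentiableAt I' I'.tangent
      (fun z ↦ (⟨z, S i z⟩ : TangentBundle I' N)) (ι x) := fun i ↦ mdiffAt_extend _
  have hSι : ∀ i, MDiffAlongAt I I' ι (fun z ↦ S i (ι z)) x := fun i ↦
    (hS i).comp (f := ι) x hι
  -- Differentiability is carried along with `P` because the hypothesis `add` asks for it. The full
  -- sum equals `V` only near `x`, which is why `congr` is also needed.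
  have hsum : ∀ s : Finset _, MDiffAlongAt I I' ι (fun z ↦ ∑ i ∈ s, f i z • S i (ι z)) x ∧
      P (fun z ↦ ∑ i ∈ s, f i z • S i (ι z)) := by
    intro s
    induction s using Finset.induction_on with
    | empty =>
      have h0 : MDifferentiableAt I' I'.tangent
        (fun z ↦ (⟨z, 0⟩ : TangentBundle I' N)) (ι x) := mdifferentiableAt_zeroSection ..
      simp only [Finset.sum_empty]
      exact ⟨h0.comp (f := ι) x hι, comp _ h0⟩
    | insert i s hi ih =>
      simp only [Finset.sum_insert hi]
      exact ⟨((hSι i).smul (hf i)).add ih.1,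
        add _ _ ((hSι i).smul (hf i)) ih.1 (smul _ _ (hf i) (hSι i) (comp _ (hS i))) ih.2⟩
  refine congr _ _ (hsum Finset.univ).1 ?_ (hsum Finset.univ).2
  filter_upwards [eventually_mem_baseSet hι] with z hz
  calc ∑ i, f i z • S i (ι z) = e.symmL ℝ (ι z) (∑ i, f i z • b i) := by
        simp only [map_sum, map_smul, S, extend_apply_eq_symmL _ hz]
        rw [Finset.sum_congr rfl fun i _ ↦ ?_]
        rw [Trivialization.continuousLinearMapAt_symmL _ hx]
    _ = e.symmL ℝ (ι z) (coordAlong ι V x z) := by rw [b.sum_repr]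
    _ = V z := by
      rw [coordAlong_self_apply _ _ _ hz]
      exact Trivialization.symmL_continuousLinearMapAt _ hz _

end Along

/-! ### Parallel endomorphisms, metric and torsion along a map. -/

section AlongConnection

variable {E : Type*} [NormedAddCommGroup E] [NormedSpace ℝ E]
  {H : Type*} [TopologicalSpace H] {I : ModelWithCorners ℝ E H}
  {M : Type*} [TopologicalSpace M] [ChartedSpace H M]
  {E' : Type*} [NormedAddCommGroup E'] [NormedSpace ℝ E'] [FiniteDimensional ℝ E']
  {H' : Type*} [TopologicalSpace H'] {I' : ModelWithCorners ℝ E' H'}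
  {N : Type*} [TopologicalSpace N] [ChartedSpace H' N] [IsManifold I' ∞ N]
  {ι : M → N} {V W : ∀ x : M, TangentSpace I' (ι x)} {x : M}
  {D : CovariantDerivative I' E' (fun y : N ↦ TangentSpace I' y)}

omit [FiniteDimensional ℝ E'] in
lemma MDiffAlongAt.endomorphism {J : ∀ y : N, TangentSpace I' y →L[ℝ] TangentSpace I' y}
    (hJ : IsSmoothEndomorphismField J) (hV : MDiffAlongAt I I' ι V x) :
    MDiffAlongAt I I' ι (fun z ↦ J (ι z) (V z)) x :=
  MDifferentiableAt.clm_bundle_apply (F₁ := E') (F₂ := E') (E₁ := fun y : N ↦ TangentSpace I' y)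
    (E₂ := fun y : N ↦ TangentSpace I' y) (b := ι) (ϕ := fun z ↦ J (ι z))
    (((hJ (ι x)).mdifferentiableAt (by simp)).comp (f := ι) x (mdiffAlongAt_iff.1 hV).1) hV

/-- A parallel field of endomorphisms commutes with covariant differentiation along a map. -/
theorem covDerivAlong_endomorphism {J : ∀ y : N, TangentSpace I' y →L[ℝ] TangentSpace I' y}
    (hJ : IsSmoothEndomorphismField J)
    (hDJ : ∀ (Y : ∀ y : N, TangentSpace I' y) (y : N),
      MDifferentiableAt I' I'.tangent (fun z ↦ (⟨z, Y z⟩ : TangentBundle I' N)) y →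
      ∀ u : TangentSpace I' y, D (fun z ↦ J z (Y z)) y u = J y (D Y y u))
    (hV : MDiffAlongAt I I' ι V x) (v : TangentSpace I x) :
    covDerivAlong I D ι (fun z ↦ J (ι z) (V z)) x v = J (ι x) (covDerivAlong I D ι V x v) := by
  have hι := (mdiffAlongAt_iff.1 hV).1
  refine hV.induction (P := fun V ↦ covDerivAlong I D ι (fun z ↦ J (ι z) (V z)) x v =
    J (ι x) (covDerivAlong I D ι V x v)) hι ?_ ?_ ?_ ?_
  · intro V W _ h hP
    have hJ' : ∀ᶠ z in 𝓝 x, J (ι z) (V z) = J (ι z) (W z) := h.mono fun z hz ↦ by rw [hz]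
    rw [← covDerivAlong_congr h, ← hP, covDerivAlong_congr hJ']
  · intro V W hV hW hPV hPW
    simp only [map_add]
    rw [covDerivAlong_add (hV.endomorphism hJ) (hW.endomorphism hJ), covDerivAlong_add hV hW,
      add_apply, add_apply, hPV, hPW, map_add]
  · intro f V hf hV hP
    simp only [map_smul]
    rw [covDerivAlong_smul hf (hV.endomorphism hJ), covDerivAlong_smul hf hV, hP, map_add,
      map_smul, map_smul]
  · intro S hS
    have hJS : MDifferentiableAt I' I'.tangent
        (fun z ↦ (⟨z, J z (S z)⟩ : TangentBundle I' N)) (ι x) :=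
      MDiffAlongAt.endomorphism (ι := id) hJ hS
    rw [covDerivAlong_comp hι hS]
    exact (congrArg (fun L ↦ L v) (covDerivAlong_comp (D := D) hι hJS)).trans (hDJ S _ hS _)

section Metric

variable [RiemannianBundle (fun y : N ↦ TangentSpace I' y)]
  [IsContMDiffRiemannianBundle I' ∞ E' (fun y : N ↦ TangentSpace I' y)]

omit [FiniteDimensional ℝ E'] in
lemma MDiffAlongAt.inner (hV : MDiffAlongAt I I' ι V x) (hW : MDiffAlongAt I I' ι W x) :
    MDifferentiableAt I 𝓘(ℝ, ℝ) (fun z ↦ inner ℝ (V z) (W z)) x := by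
  have : IsContMDiffRiemannianBundle I' 1 E' (fun y : N ↦ TangentSpace I' y) :=
    .of_le (n := ∞) (by simp)
  exact MDifferentiableAt.inner_bundle (IB := I') (F := E') (E := fun y : N ↦ TangentSpace I' y)
    (b := ι) hV hW

/-- A metric connection satisfies the product rule for inner products of vector fields along a
map. -/
theorem mvfderiv_inner_along (hD : IsLeviCivita D)
    (hV : MDiffAlongAt I I' ι V x) (hW : MDiffAlongAt I I' ι W x) (v : TangentSpace I x) :
    mvfderiv I (fun z ↦ inner ℝ (V z) (W z)) x v =
      inner ℝ (covDerivAlong I D ι V x v) (W x) + inner ℝ (V x) (covDerivAlong I D ι W x v) := by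
  have hι := (mdiffAlongAt_iff.1 hV).1
  refine hV.induction (P := fun V ↦ mvfderiv I (fun z ↦ inner ℝ (V z) (W z)) x v =
      inner ℝ (covDerivAlong I D ι V x v) (W x) + inner ℝ (V x) (covDerivAlong I D ι W x v))
      hι ?_ ?_ ?_ ?_
  · intro V V' _ h hP
    have hi : (fun z ↦ inner ℝ (V z) (W z)) =ᶠ[𝓝 x] fun z ↦ inner ℝ (V' z) (W z) :=
      h.mono fun z hz ↦ congrArg (fun u ↦ inner ℝ u (W z)) hz
    rw [← covDerivAlong_congr h, ← h.self_of_nhds, ← hP, mvfderiv_congr hi]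
  · intro V V' hV hV' hP hP'
    simp only [inner_add_left]
    rw [mvfderiv_fun_add (hV.inner hW) (hV'.inner hW), covDerivAlong_add hV hV', add_apply,
      add_apply, hP, hP', inner_add_left]
    ring
  · intro f V hf hV hP
    simp only [inner_smul_left]
    rw [covDerivAlong_smul hf hV, inner_add_left, inner_smul_left, inner_smul_left]
    have := congrArg (fun L ↦ L v) (mvfderiv_fun_mul hf (hV.inner hW))
    simp at this ⊢
    rw [this, hP]
    ring
  -- The first field is now a restriction from `N`; a second induction reduces the other one,
  -- leaving the metric property of `D` itself.
  intro S hS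
  have hSι : MDiffAlongAt I I' ι (fun z ↦ S (ι z)) x := hS.comp (f := ι) x hι
  refine hW.induction (P := fun W ↦ mvfderiv I (fun z ↦ inner ℝ (S (ι z)) (W z)) x v =
      inner ℝ (covDerivAlong I D ι (fun z ↦ S (ι z)) x v) (W x)
        + inner ℝ (S (ι x)) (covDerivAlong I D ι W x v)) hι ?_ ?_ ?_ ?_
  · intro V V' _ h hP
    have hi : (fun z ↦ inner ℝ (S (ι z)) (V z)) =ᶠ[𝓝 x] fun z ↦ inner ℝ (S (ι z)) (V' z) :=
      h.mono fun z hz ↦ congrArg (fun u ↦ inner ℝ (S (ι z)) u) hz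
    rw [← covDerivAlong_congr h, ← h.self_of_nhds, ← hP, mvfderiv_congr hi]
  · intro V V' hV hV' hP hP'
    simp only [inner_add_right]
    rw [mvfderiv_fun_add (hSι.inner hV) (hSι.inner hV'), covDerivAlong_add hV hV', add_apply,
      add_apply, hP, hP', inner_add_right]
    ring
  · intro f V hf hV hP
    simp only [inner_smul_right]
    rw [covDerivAlong_smul hf hV, inner_add_right, inner_smul_right, inner_smul_right]
    have := congrArg (fun L ↦ L v) (mvfderiv_fun_mul hf (hSι.inner hV))
    simp at this ⊢
    rw [this, hP]
    ring
  · intro T hT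
    have hg : MDifferentiableAt I' 𝓘(ℝ, ℝ) (fun y ↦ inner ℝ (S y) (T y)) (ι x) :=
      MDiffAlongAt.inner (ι := id) hS hT
    rw [covDerivAlong_comp hι hS, covDerivAlong_comp hι hT]
    exact (mvfderiv_comp_apply x hg hι v).trans (hD.metric S T _ hS hT _)

end Metric

section Torsion

omit [FiniteDimensional ℝ E'] in
-- The field `dι X` is the smooth tangent map of `ι` composed with the section `X`.
lemma MDiffAlongAt.pushforward [IsManifold I 1 M] (hι : ContMDiff I I' ∞ ι)
    {X : ∀ x : M, TangentSpace I x}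
    (hX : MDifferentiableAt I I.tangent (fun z ↦ (⟨z, X z⟩ : TangentBundle I M)) x) :
    MDiffAlongAt I I' ι (fun z ↦ mfderiv I I' ι z (X z)) x := by
  have h := hι.contMDiff_tangentMap (m := ∞) le_rfl
  exact ((h _).mdifferentiableAt (by simp)).comp
    (f := fun z ↦ (⟨z, X z⟩ : TangentBundle I M)) x hX

omit [FiniteDimensional ℝ E'] in
-- Coordinates in the trivialization are derivatives of the chart, so `mvfderiv_mlieBracket` can be
-- applied to the vector-valued chart function.
lemma continuousLinearMapAt_eq_mvfderiv {y₀ y : N}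
    (hy : y ∈ (trivializationAt E' (fun y : N ↦ TangentSpace I' y) y₀).baseSet)
    (u : TangentSpace I' y) :
    (trivializationAt E' (fun y : N ↦ TangentSpace I' y) y₀).continuousLinearMapAt ℝ y u =
      mvfderiv I' (extChartAt I' y₀) y u :=
  congrArg (fun L : TangentSpace I' y →L[ℝ] E' ↦ L u)
    (TangentBundle.continuousLinearMapAt_trivializationAt hy)

/-- Vector fields with constant coordinates commute. -/
lemma mlieBracket_extend [I'.Boundaryless] {y₀ : N} (u w : TangentSpace I' y₀) :
    mlieBracket I' (FiberBundle.extend E' (E := fun y : N ↦ TangentSpace I' y) u)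
      (FiberBundle.extend E' (E := fun y : N ↦ TangentSpace I' y) w) y₀ = 0 := by
  have hc : ∀ u : TangentSpace I' y₀, mvfderiv I' (fun z ↦ mvfderiv I' (extChartAt I' y₀) z
      (FiberBundle.extend E' (E := fun y : N ↦ TangentSpace I' y) u z)) y₀ = 0 := by
    intro u
    refine mvfderiv_const_of_eventually (c :=
      (trivializationAt E' (fun y : N ↦ TangentSpace I' y) y₀).continuousLinearMapAt ℝ y₀ u) ?_
    filter_upwards [eventually_baseSet (I' := I') y₀] with y hy
    rw [← continuousLinearMapAt_eq_mvfderiv hy, extend_apply_eq_symmL u hy,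
      Trivialization.continuousLinearMapAt_symmL _ hy]
  -- With the chart as test function, both iterated derivatives vanish by `hc`; hence so do the
  -- coordinates of the bracket.
  have h := mvfderiv_mlieBracket (f := extChartAt I' y₀)
    (contMDiffAt_extChartAt (n := 2)) (mdiffAt_extend u) (mdiffAt_extend w)
  have hx := mem_baseSet_trivializationAt E' (fun y : N ↦ TangentSpace I' y) y₀
  rw [hc, hc, ← continuousLinearMapAt_eq_mvfderiv hx] at h
  rw [← Trivialization.symmL_continuousLinearMapAt (R := ℝ) _ hx (mlieBracket I' _ _ y₀), ← h]
  simp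

/-- A torsion-free connection is torsion-free along maps: `D_X (dι Y) - D_Y (dι X) = dι [X, Y]`. -/
theorem covDerivAlong_pushforward_sub [FiniteDimensional ℝ E] [IsManifold I ∞ M] [I.Boundaryless]
    [I'.Boundaryless] (hD : D.torsion = 0) (hι : ContMDiff I I' ∞ ι)
    {X Y : ∀ x : M, TangentSpace I x}
    (hX : MDifferentiableAt I I.tangent (fun z ↦ (⟨z, X z⟩ : TangentBundle I M)) x)
    (hY : MDifferentiableAt I I.tangent (fun z ↦ (⟨z, Y z⟩ : TangentBundle I M)) x) :
    covDerivAlong I D ι (fun z ↦ mfderiv I I' ι z (Y z)) x (X x)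
      - covDerivAlong I D ι (fun z ↦ mfderiv I I' ι z (X z)) x (Y x)
      = mfderiv I I' ι x (mlieBracket I X Y x) := by
  set φ := extChartAt I' (ι x)
  have hιd : ∀ z, MDifferentiableAt I I' ι z := fun z ↦ (hι z).mdifferentiableAt (by simp)
  have hcomp : ∀ᶠ z in 𝓝 x, ∀ v : TangentSpace I z, mvfderiv I (φ ∘ ι) z v =
      (trivializationAt E' (fun y : N ↦ TangentSpace I' y) (ι x)).continuousLinearMapAt ℝ (ι z)
        (mfderiv I I' ι z v) := by
    filter_upwards [eventually_mem_baseSet (hιd x)] with z hz v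
    rw [continuousLinearMapAt_eq_mvfderiv hz]
    exact congrArg (fun L ↦ L v) (mfderiv_comp z (mdifferentiableAt_extChartAt hz) (hιd z))
  have hcoord : ∀ X : (∀ x : M, TangentSpace I x),
      mvfderiv I (coordAlong ι (fun z ↦ mfderiv I I' ι z (X z)) x) x =
        mvfderiv I (fun z ↦ mvfderiv I (φ ∘ ι) z (X z)) x := by
    intro X
    refine mvfderiv_congr ?_
    filter_upwards [hcomp, eventually_mem_baseSet (hιd x)] with z hz hz'
    rw [hz, coordAlong_self_apply _ _ _ hz']
  have hφι : ContMDiffAt I 𝓘(ℝ, E') 2 (φ ∘ ι) x :=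
    (contMDiffAt_extChartAt (n := 2)).comp x ((hι x).of_le ENat.LEInfty.out)
  -- Applied to `φ ∘ ι`, the commutator formula identifies the difference of the coordinate terms
  -- with `dι [X, Y]` in coordinates. The connection terms cancel by `hT`, since constant-coordinate
  -- fields commute and `D` has no torsion.
  have hb := mvfderiv_mlieBracket hφι hX hY
  have hT := (CovariantDerivative.torsion_eq_zero_iff D).1 hD
    (mdiffAt_extend (mfderiv I I' ι x (X x))) (mdiffAt_extend (mfderiv I I' ι x (Y x)))
  rw [mlieBracket_extend, FiberBundle.extend_apply_self, FiberBundle.extend_apply_self,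
    sub_eq_zero] at hT
  have hx := mem_baseSet_trivializationAt E' (fun y : N ↦ TangentSpace I' y) (ι x)
  rw [hcomp.self_of_nhds] at hb
  rw [covDerivAlong, covDerivAlong, hcoord, hcoord]
  simp only [add_apply, ContinuousLinearMap.comp_apply]
  rw [hT, add_sub_add_right_eq_sub, ← map_sub, hb,
    Trivialization.symmL_continuousLinearMapAt _ hx]

end Torsion

end AlongConnection

/-! ### Induced metric and shape operator of a hypersurface. -/

section HypersurfaceGeometry

variable {E : Type*} [NormedAddCommGroup E] [NormedSpace ℝ E] [FiniteDimensional ℝ E]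
  {H : Type*} [TopologicalSpace H] {I : ModelWithCorners ℝ E H} [I.Boundaryless]
  {M : Type*} [TopologicalSpace M] [ChartedSpace H M] [IsManifold I ∞ M]
  {E' : Type*} [NormedAddCommGroup E'] [NormedSpace ℝ E'] [FiniteDimensional ℝ E']
  {H' : Type*} [TopologicalSpace H'] {I' : ModelWithCorners ℝ E' H'} [I'.Boundaryless]
  {N : Type*} [TopologicalSpace N] [ChartedSpace H' N] [IsManifold I' ∞ N]
  [RiemannianBundle (fun y : N ↦ TangentSpace I' y)]
  [IsContMDiffRiemannianBundle I' ∞ E' (fun y : N ↦ TangentSpace I' y)]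
  {ι : M → N} {ν : ∀ x : M, TangentSpace I' (ι x)}
  {D : CovariantDerivative I' E' (fun y : N ↦ TangentSpace I' y)}

/-- The Lie derivative of the induced metric in terms of the covariant derivative along the
immersion. -/
lemma lieDerivMetric_inducedMetric (hD : IsLeviCivita D) (hι : ContMDiff I I' ∞ ι)
    {X Y Z : ∀ x : M, TangentSpace I x} {x : M}
    (hX : MDifferentiableAt I I.tangent (fun z ↦ (⟨z, X z⟩ : TangentBundle I M)) x)
    (hY : MDifferentiableAt I I.tangent (fun z ↦ (⟨z, Y z⟩ : TangentBundle I M)) x)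
    (hZ : MDifferentiableAt I I.tangent (fun z ↦ (⟨z, Z z⟩ : TangentBundle I M)) x) :
    lieDerivMetric (inducedMetric I I' ι) X Y Z x =
      inner ℝ (covDerivAlong I D ι (fun z ↦ mfderiv I I' ι z (X z)) x (Y x))
        (mfderiv I I' ι x (Z x))
      + inner ℝ (mfderiv I I' ι x (Y x))
        (covDerivAlong I D ι (fun z ↦ mfderiv I I' ι z (X z)) x (Z x)) := by
  have h := mvfderiv_inner_along hD (MDiffAlongAt.pushforward hι hY)
    (MDiffAlongAt.pushforward hι hZ) (X x)
  simp only [lieDerivMetric, inducedMetric]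
  -- Each bracket becomes a difference of covariant derivatives; the derivatives in direction `X`
  -- cancel against the product rule `h`.
  rw [h, ← covDerivAlong_pushforward_sub hD.torsion_eq_zero hι hX hY,
    ← covDerivAlong_pushforward_sub hD.torsion_eq_zero hι hX hZ, inner_sub_left, inner_sub_right]
  ring

omit [FiniteDimensional ℝ E] [I.Boundaryless] [IsManifold I ∞ M] [FiniteDimensional ℝ E']
  [I'.Boundaryless] [IsContMDiffRiemannianBundle I' ∞ E' fun y : N ↦ TangentSpace I' y] in
lemma MDiffAlongAt.normal (hν : IsImmersionWithUnitNormal I I' ι ν) (x : M) :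
    MDiffAlongAt I I' ι ν x :=
  (hν.smooth_normal x).mdifferentiableAt (by simp)

omit [FiniteDimensional ℝ E] [I.Boundaryless] [IsManifold I ∞ M] [I'.Boundaryless] in
-- Differentiate the constant function `⟨ν, ν⟩ = 1`.
lemma inner_covDerivAlong_normal (hD : IsLeviCivita D) (hν : IsImmersionWithUnitNormal I I' ι ν)
    (x : M) (v : TangentSpace I x) : inner ℝ (covDerivAlong I D ι ν x v) (ν x) = 0 := by
  have h := mvfderiv_inner_along hD (MDiffAlongAt.normal hν x) (MDiffAlongAt.normal hν x) v
  simp only [hν.unit, mvfderiv_const] at h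
  rw [zero_apply, real_inner_comm (covDerivAlong I D ι ν x v)] at h
  linarith

omit [I.Boundaryless] [IsManifold I ∞ M] [I'.Boundaryless]
  [IsContMDiffRiemannianBundle I' ∞ E' fun y : N ↦ TangentSpace I' y] in
/-- A vector orthogonal to the unit normal of a hypersurface is tangent to the hypersurface. -/
lemma exists_mfderiv_eq (hdim : Module.finrank ℝ E' = Module.finrank ℝ E + 1)
    (hν : IsImmersionWithUnitNormal I I' ι ν) (x : M) {u : TangentSpace I' (ι x)}
    (hu : inner ℝ u (ν x) = 0) : ∃ v, mfderiv I I' ι x v = u := by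
  -- The map `(v, t) ↦ dι v + tν` is injective between spaces of equal dimension, hence onto;
  -- pairing with `ν` recovers `t`, which is zero for `u`.
  let L : E × ℝ →ₗ[ℝ] TangentSpace I' (ι x) :=
    LinearMap.coprod (mfderiv I I' ι x).toLinearMap (LinearMap.toSpanSingleton ℝ _ (ν x))
  have hL : ∀ (v : TangentSpace I x) (t : ℝ), L (v, t) = mfderiv I I' ι x v + t • ν x :=
    fun v t ↦ LinearMap.coprod_apply ..
  have hLν : ∀ (v : TangentSpace I x) (t : ℝ), inner ℝ (L (v, t)) (ν x) = t := fun v t ↦ by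
    rw [hL, inner_add_left, hν.normal, real_inner_smul_left, hν.unit, mul_one, zero_add]
  have hinj : Function.Injective L := by
    rw [← LinearMap.ker_eq_bot, LinearMap.ker_eq_bot']
    rintro ⟨v, t⟩ h0
    obtain rfl : t = 0 := by rw [← hLν v t, h0, inner_zero_left]
    rw [hL v 0, zero_smul, add_zero] at h0
    exact Prod.ext (hν.injective x (h0.trans (map_zero _).symm)) rfl
  have hfd : FiniteDimensional ℝ (TangentSpace I' (ι x)) := inferInstanceAs (FiniteDimensional ℝ E')
  have hfr : Module.finrank ℝ (E × ℝ) = Module.finrank ℝ (TangentSpace I' (ι x)) := by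
    rw [Module.finrank_prod, Module.finrank_self]
    exact hdim.symm
  obtain ⟨⟨v, t⟩, rfl⟩ :=
    (LinearMap.injective_iff_surjective_of_finrank_eq_finrank hfr).1 hinj u
  refine ⟨v, ?_⟩
  rw [hLν v t] at hu
  rw [hL v t, hu, zero_smul, add_zero]

omit [I.Boundaryless] [IsManifold I ∞ M] [I'.Boundaryless] in
/-- The Weingarten formula. -/
lemma mfderiv_shapeOperator (hdim : Module.finrank ℝ E' = Module.finrank ℝ E + 1)
    (hD : IsLeviCivita D) (hν : IsImmersionWithUnitNormal I I' ι ν) (x : M)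
    (v : TangentSpace I x) :
    mfderiv I I' ι x (shapeOperator I D ι ν x v) = -covDerivAlong I D ι ν x v := by
  -- The left inverse in `shapeOperator` undoes `dι` only on its range, so `D_v ν` must first be
  -- shown tangent.
  obtain ⟨w, hw⟩ := exists_mfderiv_eq hdim hν x (inner_covDerivAlong_normal hD hν x v)
  have h : shapeOperator I D ι ν x v = -w := by
    have hk : (mfderiv I I' ι x).toLinearMap.ker = ⊥ := LinearMap.ker_eq_bot.2 (hν.injective x)
    have := LinearMap.leftInverse_apply_of_inj hk w
    rw [← this]
    simp [shapeOperator, ← hw]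
  rw [h, map_neg, hw]

/-- The shape operator is symmetric. -/
lemma inducedMetric_shapeOperator (hdim : Module.finrank ℝ E' = Module.finrank ℝ E + 1)
    (hD : IsLeviCivita D) (hν : IsImmersionWithUnitNormal I I' ι ν) (x : M)
    (v w : TangentSpace I x) :
    inducedMetric I I' ι x (shapeOperator I D ι ν x v) w =
      inducedMetric I I' ι x v (shapeOperator I D ι ν x w) := by
  -- Differentiating `⟨dι Y, ν⟩ = 0` gives `g(Av, w) = ⟨D_v (dι Y), ν⟩`, the second fundamental
  -- form, for any extension `Y` of `w`.
  have key : ∀ v w : TangentSpace I x, ∀ Y : (∀ x : M, TangentSpace I x), Y x = w →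
      MDifferentiableAt I I.tangent (fun z ↦ (⟨z, Y z⟩ : TangentBundle I M)) x →
      inducedMetric I I' ι x (shapeOperator I D ι ν x v) w =
        inner ℝ (covDerivAlong I D ι (fun z ↦ mfderiv I I' ι z (Y z)) x v) (ν x) := by
    intro v w Y hw hY
    have h := mvfderiv_inner_along hD (MDiffAlongAt.pushforward hν.smooth hY)
      (MDiffAlongAt.normal hν x) v
    simp only [hν.normal, mvfderiv_const] at h
    rw [inducedMetric, mfderiv_shapeOperator hdim hD hν, inner_neg_left, ← hw, real_inner_comm]
    rw [zero_apply] at h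
    linarith
  have hv := mdiffAt_extend v
  have hw := mdiffAt_extend w
  have hsymm : inducedMetric I I' ι x v (shapeOperator I D ι ν x w) =
      inducedMetric I I' ι x (shapeOperator I D ι ν x w) v := real_inner_comm _ _
  rw [hsymm, key v w _ (FiberBundle.extend_apply_self ..) hw,
    key w v _ (FiberBundle.extend_apply_self ..) hv, ← sub_eq_zero, ← inner_sub_left]
  -- The antisymmetric part of the second fundamental form is `⟨dι [·, ·], ν⟩`, which is zero
  -- because brackets of tangent fields are tangent.
  have := covDerivAlong_pushforward_sub hD.torsion_eq_zero hν.smooth hv hw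
  rw [FiberBundle.extend_apply_self, FiberBundle.extend_apply_self] at this
  rw [this, hν.normal]

omit [FiniteDimensional ℝ E] [I.Boundaryless] [IsManifold I ∞ M] [FiniteDimensional ℝ E']
  [I'.Boundaryless] [IsContMDiffRiemannianBundle I' ∞ E' fun y : N ↦ TangentSpace I' y] in
lemma inducedMetric_eq_zero_iff (hν : IsImmersionWithUnitNormal I I' ι ν) (x : M)
    {v : TangentSpace I x} : (∀ w, inducedMetric I I' ι x v w = 0) ↔ v = 0 := by
  refine ⟨fun h ↦ hν.injective x ?_, fun h w ↦ by simp [inducedMetric, h]⟩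
  rw [map_zero]
  exact inner_self_eq_zero.1 (h v)

/-! ### The characteristic vector field and the Killing condition. -/

variable {p q : ℕ} {J : ∀ y : N, TangentSpace I' y →L[ℝ] TangentSpace I' y}
  {φ : ∀ x : M, TangentSpace I x →L[ℝ] TangentSpace I x} {η : ∀ x : M, TangentSpace I x →L[ℝ] ℝ}
  {ξ : ∀ x : M, TangentSpace I x}

omit [I.Boundaryless] [I'.Boundaryless] in
-- Compute `D_v (Jν)` twice: as `q D_v ξ + p D_v ν` from `Jν = qξ + pν`, and as `J (D_v ν) = -J (dι
-- (Av))`, which `J_tangent` splits into tangent and normal parts.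
lemma covDerivAlong_characteristic (hdim : Module.finrank ℝ E' = Module.finrank ℝ E + 1)
    (hN : IsLocallyMetallic p q D J) (hM : IsQuadraticMetricHypersurface p q J ι ν φ η ξ)
    (x : M) (v : TangentSpace I x) :
    (q : ℝ) • covDerivAlong I D ι (fun z ↦ mfderiv I I' ι z (ξ z)) x v =
      mfderiv I I' ι x ((p : ℝ) • shapeOperator I D ι ν x v - φ x (shapeOperator I D ι ν x v))
        - η x (shapeOperator I D ι ν x v) • ν x := by
  have hν := hM.immersion
  have hξ := MDiffAlongAt.pushforward hν.smooth
    ((hM.almostQuadratic.smooth_ξ x).mdifferentiableAt (by simp))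
  have hνd := MDiffAlongAt.normal hν x
  have h1 := covDerivAlong_endomorphism (D := D) hN.metallic.smooth hN.parallel hνd v
  have h2 : covDerivAlong I D ι (fun z ↦ J (ι z) (ν z)) x v =
      (q : ℝ) • covDerivAlong I D ι (fun z ↦ mfderiv I I' ι z (ξ z)) x v
        + (p : ℝ) • covDerivAlong I D ι ν x v := by
    rw [covDerivAlong_congr (Eventually.of_forall hM.J_normal),
      covDerivAlong_add (hξ.smul mdifferentiableAt_const) (hνd.smul mdifferentiableAt_const),
      covDerivAlong_const_smul _ hξ, covDerivAlong_const_smul _ hνd]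
    rfl
  have hA := mfderiv_shapeOperator hN.leviCivita hν x v (hdim := hdim)
  have hA' : covDerivAlong I D ι ν x v = -mfderiv I I' ι x (shapeOperator I D ι ν x v) := by
    rw [hA, neg_neg]
  rw [h2, hA', map_neg, hM.J_tangent] at h1
  rw [map_sub, map_smul]
  rw [smul_neg, ← sub_eq_add_neg, sub_eq_iff_eq_add] at h1
  rw [h1]
  abel

/-- `q L_ξ g` is the bilinear form of `2pA - φA - Aφ`. -/
lemma lieDerivMetric_characteristic (hdim : Module.finrank ℝ E' = Module.finrank ℝ E + 1)
    (hN : IsLocallyMetallic p q D J) (hM : IsQuadraticMetricHypersurface p q J ι ν φ η ξ)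
    {Y Z : ∀ x : M, TangentSpace I x} {x : M}
    (hY : MDifferentiableAt I I.tangent (fun z ↦ (⟨z, Y z⟩ : TangentBundle I M)) x)
    (hZ : MDifferentiableAt I I.tangent (fun z ↦ (⟨z, Z z⟩ : TangentBundle I M)) x) :
    (q : ℝ) * lieDerivMetric (inducedMetric I I' ι) ξ Y Z x =
      inducedMetric I I' ι x ((2 * (p : ℝ)) • shapeOperator I D ι ν x (Y x)
        - (φ x (shapeOperator I D ι ν x (Y x)) + shapeOperator I D ι ν x (φ x (Y x)))) (Z x) := by
  have hν := hM.immersion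
  have hξ := (hM.almostQuadratic.smooth_ξ x).mdifferentiableAt (by simp)
  -- Symmetry moves all operators onto `Y`: `g(Y, AZ) = g(AY, Z)` and `g(Y, φAZ) = g(φY, AZ) =
  -- g(AφY, Z)`.
  have hs := inducedMetric_shapeOperator hdim hN.leviCivita hν x
  have hY' := hs (Y x) (Z x)
  have hφ := hM.compatible x (Y x) (shapeOperator I D ι ν x (Z x))
  have hφA := hs (φ x (Y x)) (Z x)
  rw [lieDerivMetric_inducedMetric hN.leviCivita hν.smooth hξ hY hZ, mul_add,
    ← real_inner_smul_left, ← real_inner_smul_right,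
    covDerivAlong_characteristic hdim hN hM, covDerivAlong_characteristic hdim hN hM]
  have hn : ∀ v, inner ℝ (ν x) (mfderiv I I' ι x v) = 0 := fun v ↦ by
    rw [real_inner_comm]; exact hν.normal x v
  simp only [inducedMetric, map_sub, map_add, map_smul, inner_sub_left, inner_sub_right,
    inner_add_left, real_inner_smul_left, real_inner_smul_right, hn, hν.normal] at hY' hφ hφA ⊢
  linear_combination -(p : ℝ) * hY' + hφ + hφA

/-- The characteristic vector field is Killing iff `φA + Aφ = 2pA`. -/
theorem isKilling_characteristic_iff (hdim : Module.finrank ℝ E' = Module.finrank ℝ E + 1)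
    (hN : IsLocallyMetallic p q D J) (hM : IsQuadraticMetricHypersurface p q J ι ν φ η ξ) :
    IsKilling (inducedMetric I I' ι) ξ ↔
      ∀ x : M, (φ x).toLinearMap ∘ₗ shapeOperator I D ι ν x
          + shapeOperator I D ι ν x ∘ₗ (φ x).toLinearMap
        = (2 * (p : ℝ)) • shapeOperator I D ι ν x := by
  have hq : (q : ℝ) ≠ 0 := by exact_mod_cast hN.metallic.q_pos.ne'
  constructor
  · intro h x
    ext v
    refine (sub_eq_zero.1 ((inducedMetric_eq_zero_iff hM.immersion x).1 fun w ↦ ?_)).symm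
    -- The Killing condition concerns fields, so `v` and the test vector `w` are extended to fields
    -- differentiable at `x`.
    have hv := mdiffAt_extend v
    have hw := mdiffAt_extend w
    have := lieDerivMetric_characteristic hdim hN hM hv hw
    rw [h _ _ x hv hw, mul_zero, FiberBundle.extend_apply_self,
      FiberBundle.extend_apply_self] at this
    exact this.symm
  · intro h Y Z x hY hZ
    have hx : φ x (shapeOperator I D ι ν x (Y x)) + shapeOperator I D ι ν x (φ x (Y x)) =
      (2 * (p : ℝ)) • shapeOperator I D ι ν x (Y x) := LinearMap.congr_fun (h x) (Y x)
    have := lieDerivMetric_characteristic hdim hN hM hY hZ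
    rw [sub_eq_zero.2 (Eq.symm hx), (inducedMetric_eq_zero_iff hM.immersion x).2 rfl] at this
    exact (mul_eq_zero.1 this).resolve_left hq

end HypersurfaceGeometry

end MetallicGeometry

open MetallicGeometry in
theorem mainTheorem7 {n : ℕ} {M N : Type*}
    [TopologicalSpace M] [ChartedSpace (EuclideanSpace ℝ (Fin n)) M] [IsManifold (𝓡 n) ∞ M]
    [TopologicalSpace N] [ChartedSpace (EuclideanSpace ℝ (Fin (n + 1))) N]
    [IsManifold (𝓡 (n + 1)) ∞ N]
    [RiemannianBundle (fun y : N ↦ TangentSpace (𝓡 (n + 1)) y)]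
    [IsContMDiffRiemannianBundle (𝓡 (n + 1)) ∞ (EuclideanSpace ℝ (Fin (n + 1)))
      (fun y : N ↦ TangentSpace (𝓡 (n + 1)) y)]
    (p q : ℕ)
    (D : CovariantDerivative (𝓡 (n + 1)) (EuclideanSpace ℝ (Fin (n + 1)))
      (fun y : N ↦ TangentSpace (𝓡 (n + 1)) y))
    (J : ∀ y : N, TangentSpace (𝓡 (n + 1)) y →L[ℝ] TangentSpace (𝓡 (n + 1)) y)
    (hN : IsLocallyMetallic p q D J)
    (ι : M → N) (ν : ∀ x : M, TangentSpace (𝓡 (n + 1)) (ι x))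
    (φ : ∀ x : M, TangentSpace (𝓡 n) x →L[ℝ] TangentSpace (𝓡 n) x)
    (η : ∀ x : M, TangentSpace (𝓡 n) x →L[ℝ] ℝ)
    (ξ : ∀ x : M, TangentSpace (𝓡 n) x)
    (hM : IsQuadraticMetricHypersurface p q J ι ν φ η ξ) :
    IsKilling (inducedMetric (𝓡 n) (𝓡 (n + 1)) ι) ξ ↔
      ∀ x : M, (φ x).toLinearMap ∘ₗ shapeOperator (𝓡 n) D ι ν x
          + shapeOperator (𝓡 n) D ι ν x ∘ₗ (φ x).toLinearMap
        = (2 * (p : ℝ)) • shapeOperator (𝓡 n) D ι ν x := by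
  -- The goal left to `simp` is the codimension-one identity of dimensions.
  exact isKilling_characteristic_iff (by simp) hN hM
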